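/- Let $\Bbbk$ be a field and let $a_1,\dots,a_n\in\mathbb N^r$ be such that no $a_i$ is a linear combination of the others with coefficients in $\mathbb N$. Let $A\colon\mathbb N^n\to\mathbb Z^r$, $u\mapsto\sum_i u_ia_i$, and let $Q=\operatorname{im}A$, the pointed affine semigroup with minimal generating set $\mathcal M=\{a_1,\dots,a_n\}$; it is a poset via $b\le c$ if and only if $b+q=c$ for some $q\in Q$. For $I\subseteq\mathcal M$ put $\deg I=\sum_{a\in I}a$. A *least upper bound in $Q$* of a set $S\subseteq Q$ is understood as a minimal one: an upper bound $c\in Q$ of $S$ such that no $b\in Q$ with $b<c$ is an upper bound of $S$ (several such $c$ may exist). Let $\mathcal C$ be the action category of $\mathbb N^n$ on $\mathbb Z^r$ via $A$: its objects are the elements of $\mathbb Z^r$, the morphisms $c\to d$ are the $u\in\mathbb N^n$ with $A(u)+c=d$ (that is, the monomials $x^u$ of degree $d-c$), and composition is addition. A $\Bbbk\mathcal C$-module is a functor from $\mathcal C$ to $\Bbbk$-vector spaces. The toric ring $\Bbbk[Q]$, a $\mathbb Z^r$-graded module over $\Bbbk[x_1,\dots,x_n]$ with $\deg x_i=a_i$,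 is regarded as the $\Bbbk\mathcal C$-module sending $c$ to the component $\Bbbk[Q]_c$. An epimorphism $f\colon L\to M$ is superfluous if, for every $g\colon K\to L$, $g$ is epic if and only if $fg$ is epic. A projective resolution $P_\bullet\to M$ is minimal if $P_0\to M$ and all $P_n\to\operatorname{im}(P_n\to P_{n-1})$, $n\ge1$, are superfluous epimorphisms. For a $\Bbbk\mathcal C$-module $M$ let $\operatorname{spl}M(c)$ be the quotient of $M(c)$ by the sum of the images of $M(u)$ over all non-isomorphisms $u\colon b\to c$. The *Betti category* of $\Bbbk[Q]$ is the full subcategory of $\mathcal C$ on the objects $c$ (the *Betti degrees*) with $\operatorname{spl}P_n(c)\ne0$ for some $n$, where $P_\bullet$ is the minimal projective resolution of $\Bbbk[Q]$ (unique up to isomorphism). The *lub-category* $\mathcal L(Q)$ is the full subcategory of $\mathcal C$ on the objects $c\in Q$ for which there is a set $\{I_1,\dots,I_m\}$ of subsets of $\mathcal M$ such that $c$ is a least upper bound in $Q$ of $\{\deg I_1,\dots,\deg I_m\}$. **Lemma.** The Betti category of $\Bbbk[Q]$ is a (full) subcategory of $\mathcal L(Q)$. More precisely, every Betti degree $c$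 of $\Bbbk[Q]$ lies in $Q$ and is a least upper bound in $Q$ of the degrees of the facets (the inclusion-maximal faces) of the simplicial complex $\Delta_c=\{I\subseteq\mathcal M\mid\deg I\le c\}$. -/

import Mathlib

open CategoryTheory

namespace ToricBetti

noncomputable section

/-! ### Modules over a category, minimal projective resolutions, Betti categories -/

section General

universe w v u

variable {A : Type u} [Category.{v} A]

/-- A superfluous epimorphism: an epimorphism `f : L ⟶ M` such that, for every morphism
`g : K ⟶ L`, `g` is epic if and only if the composite `K ⟶ L ⟶ M` is epic. -/
def IsSuperfluousEpi {L M : A} (f : L ⟶ M) : Prop :=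
  Epi f ∧ ∀ ⦃K : A⦄ (g : K ⟶ L), Epi g ↔ Epi (g ≫ f)

/-- A projective resolution `⋯ ⟶ P₁ ⟶ P₀ ⟶ M` is minimal if the augmentation `P₀ ⟶ M` and all
the corestrictions `Pₙ₊₁ ⟶ im dₙ₊₁` of the differentials are projective covers
(the `Pₙ` are projective, so this says that these epimorphisms are superfluous). -/
def IsMinimalResolution [Abelian A] {M : A} (P : ProjectiveResolution M) : Prop :=
  IsSuperfluousEpi (P.π.f 0) ∧
    ∀ n : ℕ, IsSuperfluousEpi (Limits.factorThruImage (P.complex.d (n + 1) n))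

variable {k : Type w} [CommRing k] {C : Type u} [Category.{v} C]

/-- The radical of a module `M : C ⥤ ModuleCat k` over the category `C` at the object `c`: the
sum of the images of the maps `M(u) : M(b) ⟶ M(c)` over all non-isomorphisms `u : b ⟶ c`. -/
def rad (M : C ⥤ ModuleCat.{w} k) (c : C) : Submodule k (M.obj c) :=
  ⨆ (b : C) (u : b ⟶ c) (_ : ¬ IsIso u), LinearMap.range (M.map u).hom

/-- The value of the splitting functor at `c`: the quotient of `M(c)` by the radical. -/
abbrev Spl (M : C ⥤ ModuleCat.{w} k) (c : C) : Type w := M.obj c ⧸ rad M c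

/-- The objects of the Betti category of a module `M` over `C`: those `c` such that
`Spl Pₙ (c) ≠ 0` for some term `Pₙ` of the minimal projective resolution `P` of `M`
(which is unique up to isomorphism when it exists). -/
def bettiObjects (M : C ⥤ ModuleCat.{w} k) : ObjectProperty C := fun c =>
  ∃ P : ProjectiveResolution M, IsMinimalResolution P ∧
    ∃ n : ℕ, Nontrivial (Spl (P.complex.X n) c)

/-- The Betti category of `M`, a full subcategory of `C`. -/
abbrev BettiCategory (M : C ⥤ ModuleCat.{w} k) := (bettiObjects M).FullSubcategory

end General

/-! ### Pointed affine semigroups and toric rings -/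

section Toric

variable {r n : ℕ}

/-- `a₁, …, aₙ ∈ ℕʳ` are the minimal generators of the semigroup they generate: no `aᵢ` is
a linear combination of the others with coefficients in `ℕ`.
(In particular the `aᵢ` are nonzero and pairwise distinct.) -/
def IsMinimalGenerators (a : Fin n → Fin r → ℕ) : Prop :=
  ∀ i, a i ∉ AddSubmonoid.closure (a '' {j | j ≠ i})

/-- The monoid homomorphism `A : ℕⁿ → ℤʳ`, `u ↦ ∑ᵢ uᵢ aᵢ`: the `ℤʳ`-degree of the
monomial `xᵘ`. -/
def monomialDegree (a : Fin n → Fin r → ℕ) : (Fin n → ℕ) →+ (Fin r → ℤ) where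
  toFun u := ∑ i, u i • (fun j => (a i j : ℤ))
  map_zero' := by simp
  map_add' u v := by simp [add_smul, Finset.sum_add_distrib]

/-- The affine semigroup `Q ⊆ ℤʳ` generated by `a₁, …, aₙ`. -/
def semigroup (a : Fin n → Fin r → ℕ) : AddSubmonoid (Fin r → ℤ) :=
  AddMonoidHom.mrange (monomialDegree a)

/-- The set `ℤʳ`, on which `ℕⁿ` acts through `A : ℕⁿ → ℤʳ`. -/
def Degrees (_a : Fin n → Fin r → ℕ) : Type := Fin r → ℤ

instance (a : Fin n → Fin r → ℕ) : MulAction (Multiplicative (Fin n → ℕ)) (Degrees a) where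
  smul u c := monomialDegree a u.toAdd + (show Fin r → ℤ from c)
  one_smul c := by
    change monomialDegree a 0 + (show Fin r → ℤ from c) = c
    rw [map_zero, zero_add]
  mul_smul u v c := by
    change monomialDegree a (u.toAdd + v.toAdd) + (show Fin r → ℤ from c) =
      monomialDegree a u.toAdd + (monomialDegree a v.toAdd + (show Fin r → ℤ from c))
    rw [map_add, add_assoc]

/-- The action category of `ℕⁿ` acting on `ℤʳ` through `A`: the objects are the elements of
`ℤʳ` and the morphisms `c ⟶ d` are the monomials of degree `d - c`. -/
abbrev ActCat (a : Fin n → Fin r → ℕ) : Type :=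
  ActionCategory (Multiplicative (Fin n → ℕ)) (Degrees a)

/-- The element of `ℤʳ` underlying an object of the action category. -/
def degreeOf {a : Fin n → Fin r → ℕ} (c : ActCat a) : Fin r → ℤ := c.back

/-- The exponent vector of the monomial underlying a morphism of the action category. -/
def exponent {a : Fin n → Fin r → ℕ} {c d : ActCat a} (f : c ⟶ d) : Fin n → ℕ :=
  Multiplicative.toAdd f.val

theorem exponent_spec {a : Fin n → Fin r → ℕ} {c d : ActCat a} (f : c ⟶ d) :
    monomialDegree a (exponent f) + degreeOf c = degreeOf d :=
  f.property

theorem exponent_id {a : Fin n → Fin r → ℕ} (c : ActCat a) : exponent (𝟙 c) = 0 := rfl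

theorem exponent_comp {a : Fin n → Fin r → ℕ} {c d e : ActCat a} (f : c ⟶ d) (g : d ⟶ e) :
    exponent (f ≫ g) = exponent g + exponent f := rfl

/-- The toric ring `k[Q]`. -/
abbrev ToricRing (k : Type*) [CommRing k] (a : Fin n → Fin r → ℕ) : Type _ :=
  AddMonoidAlgebra k (semigroup a)

/-- The homogeneous component of `k[Q]` of degree `c ∈ ℤʳ`. -/
abbrev toricComponent (k : Type*) [CommRing k] (a : Fin n → Fin r → ℕ) (c : Fin r → ℤ) :
    Submodule k (ToricRing k a) :=
  AddMonoidAlgebra.gradeBy k (semigroup a).subtype c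

/-- The image in `k[Q]` of the monomial `xᵘ` under `xᵢ ↦ t^{aᵢ}`, that is, the monomial with
exponent `∑ᵢ uᵢ aᵢ`. -/
def toricMonomial (k : Type*) [CommRing k] (a : Fin n → Fin r → ℕ) (u : Fin n → ℕ) :
    ToricRing k a :=
  AddMonoidAlgebra.single ⟨monomialDegree a u, u, rfl⟩ 1

theorem toricMonomial_mul_mem (k : Type*) [CommRing k] (a : Fin n → Fin r → ℕ)
    {u : Fin n → ℕ} {c d : Fin r → ℤ} (h : monomialDegree a u + c = d)
    {x : ToricRing k a} (hx : x ∈ toricComponent k a c) :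
    toricMonomial k a u * x ∈ toricComponent k a d := by
  subst h
  exact SetLike.mul_mem_graded
    (AddMonoidAlgebra.single_mem_gradeBy (semigroup a).subtype
      ⟨monomialDegree a u, u, rfl⟩ (1 : k)) hx

theorem toricMonomial_zero (k : Type*) [CommRing k] (a : Fin n → Fin r → ℕ) :
    toricMonomial k a 0 = 1 := by
  have : (⟨monomialDegree a 0, 0, rfl⟩ : semigroup a) = 0 := Subtype.ext (map_zero _)
  rw [toricMonomial, this]
  rfl

theorem toricMonomial_add (k : Type*) [CommRing k] (a : Fin n → Fin r → ℕ)
    (u v : Fin n → ℕ) :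
    toricMonomial k a (u + v) = toricMonomial k a u * toricMonomial k a v := by
  have : (⟨monomialDegree a (u + v), u + v, rfl⟩ : semigroup a) =
      ⟨monomialDegree a u, u, rfl⟩ + ⟨monomialDegree a v, v, rfl⟩ :=
    Subtype.ext (map_add _ _ _)
  simp only [toricMonomial, this, AddMonoidAlgebra.single_mul_single, mul_one]

universe w

/-- Multiplication by the monomial `xᵘ`, as a map between homogeneous components of `k[Q]`. -/
def toricMul (k : Type w) [CommRing k] (a : Fin n → Fin r → ℕ) (u : Fin n → ℕ)
    {c d : Fin r → ℤ} (h : monomialDegree a u + c = d) :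
    toricComponent k a c →ₗ[k] toricComponent k a d :=
  (LinearMap.mulLeft k (toricMonomial k a u)).restrict
    fun _ hx => toricMonomial_mul_mem k a h hx

/-- The `ℤʳ`-graded `k[x₁, …, xₙ]`-module `k[Q]` as a module over the action category:
an object `c ∈ ℤʳ` is sent to the homogeneous component of `k[Q]` of degree `c`, and a monomial
acts by multiplication. -/
def toricModule (k : Type w) [CommRing k] (a : Fin n → Fin r → ℕ) :
    ActCat a ⥤ ModuleCat.{w} k where
  obj c := ModuleCat.of k (toricComponent k a (degreeOf c))
  map f := ModuleCat.ofHom (toricMul k a (exponent f) (exponent_spec f))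
  map_id c := by
    refine ModuleCat.hom_ext (LinearMap.ext fun x => Subtype.ext ?_)
    change toricMonomial k a 0 * x.1 = x.1
    rw [toricMonomial_zero, one_mul]
  map_comp f g := by
    refine ModuleCat.hom_ext (LinearMap.ext fun x => Subtype.ext ?_)
    change toricMonomial k a (exponent g + exponent f) * x.1 =
      toricMonomial k a (exponent g) * (toricMonomial k a (exponent f) * x.1)
    rw [toricMonomial_add, mul_assoc]

/-! ### The lub-category -/

/-- The partial order of `Q`: `b ≤ c` if and only if `b + q = c` for some `q ∈ Q`. -/
def LEQ (a : Fin n → Fin r → ℕ) (b c : Fin r → ℤ) : Prop :=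
  ∃ q ∈ semigroup a, b + q = c

/-- `c` is a least (that is, a minimal) upper bound of `S` in the poset `Q`: it is an upper bound
of `S` in `Q`, and there is no upper bound `b < c` of `S` in `Q`. -/
def IsMinimalUpperBound (a : Fin n → Fin r → ℕ) (S : Set (Fin r → ℤ)) (c : Fin r → ℤ) : Prop :=
  c ∈ semigroup a ∧ (∀ s ∈ S, LEQ a s c) ∧
    ∀ b ∈ semigroup a, (∀ s ∈ S, LEQ a s b) → LEQ a b c → b = c

/-- The degree `∑_{i ∈ I} aᵢ` of a set `I` of minimal generators
(given as a set of indices). -/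
def subsetDegree (a : Fin n → Fin r → ℕ) (I : Finset (Fin n)) : Fin r → ℤ :=
  ∑ i ∈ I, fun j => (a i j : ℤ)

/-- The objects of the lub-category: the elements of `Q` that are a least upper bound in `Q` of
the degrees of some set `{I₁, …, Iₘ}` of subsets of the set of minimal generators. -/
def lubObjects (a : Fin n → Fin r → ℕ) : ObjectProperty (ActCat a) := fun c =>
  degreeOf c ∈ semigroup a ∧
    ∃ F : Set (Finset (Fin n)), IsMinimalUpperBound a (subsetDegree a '' F) (degreeOf c)

/-- The lub-category of `Q`, a full subcategory of the action category. -/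
abbrev LubCategory (a : Fin n → Fin r → ℕ) := (lubObjects a).FullSubcategory

/-- The simplicial complex `Δ_c` of all sets `I` of minimal generators with `deg I ≤ c`. -/
def degreeComplex (a : Fin n → Fin r → ℕ) (c : Fin r → ℤ) : Set (Finset (Fin n)) :=
  {I | LEQ a (subsetDegree a I) c}

/-- The facets of `Δ_c`: its inclusion-maximal faces. -/
def facets (a : Fin n → Fin r → ℕ) (c : Fin r → ℤ) : Set (Finset (Fin n)) :=
  {I | Maximal (fun J => J ∈ degreeComplex a c) I}

end Toric

end

end ToricBetti

/-! Let `S` be the simple module at `c`. In a minimal resolution `P` the differentials of `Hom(P,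
S)` vanish, so acyclicity of `Hom(P, S)` forces `Hom(Pₘ, S) = 0` and hence `Spl Pₘ (c) = 0` for all
`m` (`subsingleton_spl`). It remains to show that `Ext(k[Q], S) = 0` whenever `c` violates the
conclusion. Dual Koszul sequences build `S` from the modules `coModule k a T (c - deg I)` with `I`
disjoint from `T` (`HomAcyclic.coModule_union`). For `T = ∅` these are injective and represent `N ↦
N(c - deg I)*`, so if `c ∉ Q` nothing maps to them from `k[Q]`. If `b < c` bounds all facet degrees,
pick a variable `xⱼ` dividing a monomial of degree `c - b` and take `T = {j}`. Every face `I` has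
`deg I ≤ b ≤ c - aⱼ`, so `xⱼ` acts bijectively into degree `c - deg I`, which kills `Ext` into the
module for `{j}` (`HomAcyclic.coModule_of_bijective`). -/

namespace ToricBetti

noncomputable section

/-! ### Homological algebra: vanishing of Ext and minimal resolutions -/

section Acyclic

universe v u

variable {A : Type u} [Category.{v} A] [Abelian A] {M : A}

/-- The complex `Hom(P, E)` is exact in all degrees, including degree zero. -/
def HomAcyclic (P : ProjectiveResolution M) (E : A) : Prop :=
  (∀ f : P.complex.X 0 ⟶ E, P.complex.d 1 0 ≫ f = 0 → f = 0) ∧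
    ∀ (n : ℕ) (f : P.complex.X (n + 1) ⟶ E), P.complex.d (n + 2) (n + 1) ≫ f = 0 →
      ∃ h : P.complex.X n ⟶ E, P.complex.d (n + 1) n ≫ h = f

/-- `0 ⟶ E' ⟶ E ⟶ E'' ⟶ 0` is a short exact sequence. -/
structure IsKernelOfEpi {E' E E'' : A} (i : E' ⟶ E) (p : E ⟶ E'') : Prop where
  mono : Mono i
  epi : Epi p
  comp_eq_zero : i ≫ p = 0
  exists_lift : ∀ {X : A} (h : X ⟶ E), h ≫ p = 0 → ∃ h', h' ≫ i = h

variable {P : ProjectiveResolution M} {E' E E'' : A} {i : E' ⟶ E} {p : E ⟶ E''}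

/-- The diagram chase behind the connecting map: correcting `h` by a cocycle `h₁` with the same
image in `E''` moves it into `E'` without changing its coboundary. -/
theorem IsKernelOfEpi.exists_comp_eq (hip : IsKernelOfEpi i p) {X Y : A} {d : Y ⟶ X}
    {f : Y ⟶ E'} {h h₁ : X ⟶ E} (hh : d ≫ h = f ≫ i) (hd : d ≫ h₁ = 0)
    (hp : h₁ ≫ p = h ≫ p) : ∃ g : X ⟶ E', d ≫ g = f := by
  have := hip.mono
  obtain ⟨g, hg⟩ := hip.exists_lift (h - h₁) (by rw [Preadditive.sub_comp, hp, sub_self])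
  refine ⟨g, ?_⟩
  rw [← cancel_mono i, Category.assoc, hg, Preadditive.comp_sub, hh, hd, sub_zero]

theorem IsKernelOfEpi.exists_coboundary_lift (hip : IsKernelOfEpi i p) (n : ℕ)
    (g : P.complex.X n ⟶ E'') :
    ∃ h : P.complex.X (n + 1) ⟶ E, P.complex.d (n + 2) (n + 1) ≫ h = 0 ∧
      h ≫ p = P.complex.d (n + 1) n ≫ g := by
  have := hip.epi
  have := P.projective n
  exact ⟨P.complex.d (n + 1) n ≫ Projective.factorThru g p,
    by rw [P.complex.d_comp_d_assoc, Limits.zero_comp],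
    by rw [Category.assoc, Projective.factorThru_comp]⟩

/-- Long exact sequence of Ext: vanishing for the middle and right terms gives vanishing for the
kernel. -/
theorem HomAcyclic.of_isKernelOfEpi (hip : IsKernelOfEpi i p)
    (hE : HomAcyclic P E) (hE'' : HomAcyclic P E'') : HomAcyclic P E' := by
  have := hip.mono
  refine ⟨fun f hf => ?_, fun n f hf => ?_⟩
  · rw [← cancel_mono i, Limits.zero_comp]
    exact hE.1 _ (by rw [reassoc_of% hf, Limits.zero_comp])
  · obtain ⟨h, hh⟩ := hE.2 n (f ≫ i) (by rw [reassoc_of% hf, Limits.zero_comp])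
    have hc : P.complex.d (n + 1) n ≫ h ≫ p = 0 := by
      rw [reassoc_of% hh, hip.comp_eq_zero, Limits.comp_zero]
    cases n with
    | zero => exact hip.exists_comp_eq hh Limits.comp_zero (by rw [hE''.1 _ hc, Limits.zero_comp])
    | succ m =>
      obtain ⟨g, hg⟩ := hE''.2 m _ hc
      obtain ⟨h₁, hd, hp⟩ := hip.exists_coboundary_lift m g
      exact hip.exists_comp_eq hh hd (hp.trans hg)

/-- The augmentation `P₀ ⟶ M` of a projective resolution. -/
def augmentation (P : ProjectiveResolution M) : P.complex.X 0 ⟶ M := P.π.f 0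

theorem d_comp_augmentation (P : ProjectiveResolution M) :
    P.complex.d 1 0 ≫ augmentation P = 0 :=
  P.complex_d_comp_π_f_zero

theorem exists_desc_augmentation (P : ProjectiveResolution M) (f : P.complex.X 0 ⟶ E)
    (hf : P.complex.d 1 0 ≫ f = 0) : ∃ m : M ⟶ E, augmentation P ≫ m = f :=
  ⟨P.exact₀.desc f hf, P.exact₀.g_desc f hf⟩

theorem exists_desc_of_injective (P : ProjectiveResolution M) [Injective E] (n : ℕ)
    (f : P.complex.X (n + 1) ⟶ E) (hf : P.complex.d (n + 2) (n + 1) ≫ f = 0) :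
    ∃ h : P.complex.X n ⟶ E, P.complex.d (n + 1) n ≫ h = f :=
  ⟨(P.exact_succ n).descToInjective f hf, (P.exact_succ n).comp_descToInjective f hf⟩

theorem HomAcyclic.of_injective (P : ProjectiveResolution M) [Injective E]
    (hM : ∀ m : M ⟶ E, m = 0) : HomAcyclic P E := by
  refine ⟨fun f hf => ?_, exists_desc_of_injective P⟩
  obtain ⟨m, rfl⟩ := exists_desc_augmentation P f hf
  rw [hM m, Limits.comp_zero]

/-- Here `E ⟶ E''` is an injective coresolution of `E'`, so only Ext⁰ and Ext¹ can survive; `hM` and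
`hM'` kill these two. -/
theorem HomAcyclic.of_isKernelOfEpi_of_injective (P : ProjectiveResolution M)
    (hip : IsKernelOfEpi i p) [Injective E] [Injective E'']
    (hM : ∀ m : M ⟶ E', m = 0) (hM' : ∀ m : M ⟶ E'', ∃ m' : M ⟶ E, m' ≫ p = m) :
    HomAcyclic P E' := by
  refine ⟨fun f hf => ?_, fun n f hf => ?_⟩
  · obtain ⟨m, rfl⟩ := exists_desc_augmentation P f hf
    rw [hM m, Limits.comp_zero]
  · obtain ⟨h, hh⟩ := exists_desc_of_injective P n (f ≫ i)
      (by rw [reassoc_of% hf, Limits.zero_comp])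
    have hc : P.complex.d (n + 1) n ≫ h ≫ p = 0 := by
      rw [reassoc_of% hh, hip.comp_eq_zero, Limits.comp_zero]
    cases n with
    | zero =>
      obtain ⟨m, hm⟩ := exists_desc_augmentation P _ hc
      obtain ⟨m', rfl⟩ := hM' m
      exact hip.exists_comp_eq hh (h₁ := augmentation P ≫ m')
        (by rw [← Category.assoc, d_comp_augmentation, Limits.zero_comp])
        (by rw [Category.assoc, hm])
    | succ m =>
      obtain ⟨g, hg⟩ := exists_desc_of_injective P m _ hc
      obtain ⟨h₁, hd, hp⟩ := hip.exists_coboundary_lift m g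
      exact hip.exists_comp_eq hh hd (hp.trans hg)

/-- Maps to a simple object vanish on the kernel of a superfluous epimorphism. -/
theorem IsSuperfluousEpi.comp_eq_zero {K L N S : A} {q : L ⟶ N} (hq : IsSuperfluousEpi q)
    {d : K ⟶ L} (hd : d ≫ q = 0) (f : L ⟶ S) (hS : ∀ {X : A} (g : X ⟶ S), g ≠ 0 → Epi g) :
    d ≫ f = 0 := by
  by_contra hdf
  have hf : f ≠ 0 := by
    rintro rfl
    exact hdf Limits.comp_zero
  have := hS f hf
  have := hS _ hdf
  refine hf ?_
  suffices Epi (Limits.kernel.ι f) by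
    rw [← cancel_epi (Limits.kernel.ι f), Limits.kernel.condition, Limits.comp_zero]
  -- Since `d ≫ f` is epic, `L` is the sum of `ker f` and the image of `d`. The latter dies under
  -- `q`, so `ker f` already covers `N`, and superfluity makes `ker f ⟶ L` epic.
  refine (hq.2 _).2 (Preadditive.epi_of_cancel_zero _ fun {Z} t ht => ?_)
  have := hq.1
  rw [Category.assoc] at ht
  have hex : (ShortComplex.mk _ _ (Limits.kernel.condition f)).Exact :=
    ShortComplex.exact_of_f_is_kernel _ (Limits.kernelIsKernel f)
  have : Epi (ShortComplex.mk _ _ (Limits.kernel.condition f)).g := ‹Epi f›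
  have hs : f ≫ hex.desc (q ≫ t) ht = q ≫ t := hex.g_desc _ _
  have hs₀ : hex.desc (q ≫ t) ht = 0 := by
    rw [← cancel_epi (d ≫ f), Category.assoc, hs, reassoc_of% hd, Limits.zero_comp,
      Limits.comp_zero]
  rw [← cancel_epi q, ← hs, hs₀, Limits.comp_zero, Limits.comp_zero]

theorem IsMinimalResolution.d_comp_eq_zero (hP : IsMinimalResolution P) {S : A}
    (hS : ∀ {X : A} (g : X ⟶ S), g ≠ 0 → Epi g) (n : ℕ) (f : P.complex.X n ⟶ S) :
    P.complex.d (n + 1) n ≫ f = 0 := by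
  cases n with
  | zero => exact hP.1.comp_eq_zero P.complex_d_comp_π_f_zero f hS
  | succ n =>
    refine (hP.2 n).comp_eq_zero ?_ f hS
    rw [← cancel_mono (Limits.image.ι _), Category.assoc, Limits.image.fac,
      P.complex.d_comp_d, Limits.zero_comp]

/-- An acyclic complex with zero differentials is zero. -/
theorem IsMinimalResolution.hom_eq_zero (hP : IsMinimalResolution P) {S : A}
    (hS : ∀ {X : A} (g : X ⟶ S), g ≠ 0 → Epi g) (hac : HomAcyclic P S) (n : ℕ)
    (f : P.complex.X n ⟶ S) : f = 0 := by
  have hf := hP.d_comp_eq_zero hS n f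
  cases n with
  | zero => exact hac.1 f hf
  | succ n =>
    obtain ⟨h, rfl⟩ := hac.2 n f hf
    exact hP.d_comp_eq_zero hS n h

end Acyclic

/-! ### Modules of inverse polynomials -/

section Cofree

universe w

variable (k : Type w) [Field k] {r n : ℕ} (a : Fin n → Fin r → ℕ)

/-- The object of the action category with a given degree. -/
def objOf (c : Fin r → ℤ) : ActCat a := ((show Degrees a from c) : ActCat a)

variable {a}

/-- The morphism given by a monomial. -/
def homOf {c d : ActCat a} (u : Fin n → ℕ) (h : monomialDegree a u + degreeOf c = degreeOf d) :
    c ⟶ d :=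
  ⟨Multiplicative.ofAdd u, h⟩

theorem exponent_homOf {c d : ActCat a} (u : Fin n → ℕ)
    (h : monomialDegree a u + degreeOf c = degreeOf d) : exponent (homOf u h) = u := rfl

theorem hom_ext_exponent {c d : ActCat a} {f g : c ⟶ d} (h : exponent f = exponent g) : f = g :=
  Subtype.ext h

theorem exponent_eq_zero_of_isIso {c d : ActCat a} (f : c ⟶ d) [IsIso f] : exponent f = 0 := by
  have h : exponent (inv f) + exponent f = 0 := by
    rw [← exponent_comp, IsIso.hom_inv_id, exponent_id]
  exact (add_eq_zero.1 h).2

variable (a)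

/-- The degree `c - d` component of the module of inverse polynomials, restricted to monomials
not involving the variables in `J`: functions on the set of exponents of degree `c - d`
supported on those exponents that vanish on `J`. -/
def coComponent (J : Finset (Fin n)) (c d : Fin r → ℤ) : Submodule k ((Fin n → ℕ) → k) where
  carrier := {f | ∀ u, f u ≠ 0 → monomialDegree a u + d = c ∧ ∀ j ∈ J, u j = 0}
  zero_mem' := fun _ h => absurd rfl h
  add_mem' {f g} hf hg u h := by
    by_cases hu : f u = 0
    · exact hg u fun hu' => h (by simp [hu, hu'])
    · exact hf u hu
  smul_mem' t f hf u h := hf u (right_ne_zero_of_mul h)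

/-- The module over the action category whose value at `d` consists of the functions on
the set of morphisms `d ⟶ c` which vanish on all monomials divisible by some `xⱼ`, `j ∈ J`.
For `J = ∅` it is cofree, and if `J` consists of all indices, it is simple. -/
def coModule (J : Finset (Fin n)) (c : Fin r → ℤ) : ActCat a ⥤ ModuleCat.{w} k where
  obj d := ModuleCat.of k (coComponent k a J c (degreeOf d))
  map {d d'} f := ModuleCat.ofHom <|
    (LinearMap.funLeft k k fun u : Fin n → ℕ => u + exponent f).restrict fun g hg u hu => by
      obtain ⟨h₁, h₂⟩ := hg _ hu
      refine ⟨?_, fun j hj => (add_eq_zero.1 (h₂ j hj)).1⟩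
      rw [← h₁, map_add, add_assoc, exponent_spec]
  map_id d := rfl
  map_comp f g := by
    refine ModuleCat.hom_ext (LinearMap.ext fun x => Subtype.ext (funext fun u => ?_))
    change x.1 (u + (exponent g + exponent f)) = x.1 (u + exponent g + exponent f)
    rw [add_assoc]

variable {k a}

theorem coModule_map_apply {J : Finset (Fin n)} {c : Fin r → ℤ} {d d' : ActCat a} (f : d ⟶ d')
    (x : (coModule k a J c).obj d) (u : Fin n → ℕ) :
    ((coModule k a J c).map f x).1 u = x.1 (u + exponent f) := rfl

section Functional

variable {N : ActCat a ⥤ ModuleCat.{w} k} {J : Finset (Fin n)} {c : ActCat a}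

/-- The functional on `N(c)` given by a morphism to a module of inverse polynomials. -/
def functionalOf (f : N ⟶ coModule k a J (degreeOf c)) : N.obj c →ₗ[k] k :=
  LinearMap.proj 0 ∘ₗ (coComponent k a J (degreeOf c) (degreeOf c)).subtype ∘ₗ (f.app c).hom

theorem functionalOf_map_apply (f : N ⟶ coModule k a J (degreeOf c)) {d : ActCat a} (v : d ⟶ c)
    (x : N.obj d) : functionalOf f (N.map v x) = (f.app d x).1 (exponent v) := by
  change (f.app c (N.map v x)).1 0 = _
  rw [NatTrans.naturality_apply, coModule_map_apply, zero_add]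

/-- With `homOfFunctional`, this identifies maps from `N` with the functionals on `N(c)` that kill
all multiples of the `xⱼ`, `j ∈ J`. -/
theorem functionalOf_injective :
    Function.Injective (functionalOf : (N ⟶ coModule k a J (degreeOf c)) → _) := by
  intro f g hfg
  ext d x
  refine Subtype.ext (funext fun u => ?_)
  by_cases h : monomialDegree a u + degreeOf d = degreeOf c
  · rw [← exponent_homOf u h, ← functionalOf_map_apply, ← functionalOf_map_apply, hfg]
  · have hz (y : (coModule k a J (degreeOf c)).obj d) : y.1 u = 0 :=
      by_contra fun hy => h (y.2 u hy).1
    rw [hz, hz]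

/-- The morphism to a module of inverse polynomials given by a functional on `N(c)`. -/
def homOfFunctional (φ : N.obj c →ₗ[k] k)
    (hφ : ∀ (b : ActCat a) (v : b ⟶ c) (x : N.obj b), (∃ j ∈ J, exponent v j ≠ 0) →
      φ (N.map v x) = 0) : N ⟶ coModule k a J (degreeOf c) where
  app d := ModuleCat.ofHom
    { toFun x := ⟨fun u => open Classical in
          if h : monomialDegree a u + degreeOf d = degreeOf c then φ (N.map (homOf u h) x) else 0,
        fun u hu => by
          dsimp only at hu
          split_ifs at hu with h
          · refine ⟨h, fun j hj => ?_⟩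
            by_contra hne
            exact hu (hφ _ _ _ ⟨j, hj, hne⟩)
          · exact absurd rfl hu⟩
      map_add' x y := Subtype.ext <| funext fun u => by
        by_cases h : monomialDegree a u + degreeOf d = degreeOf c <;> simp [h]
      map_smul' t x := Subtype.ext <| funext fun u => by
        by_cases h : monomialDegree a u + degreeOf d = degreeOf c <;> simp [h] }
  naturality d d' f := by
    ext x
    refine Subtype.ext (funext fun u => ?_)
    have key : monomialDegree a (u + exponent f) + degreeOf d = degreeOf c ↔
        monomialDegree a u + degreeOf d' = degreeOf c := by
      rw [map_add, add_assoc, exponent_spec]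
    change dite _ _ _ = dite _ _ _
    by_cases h : monomialDegree a u + degreeOf d' = degreeOf c
    · rw [dif_pos h, dif_pos (key.2 h)]
      exact congrArg φ (ConcreteCategory.congr_hom (N.map_comp f (homOf u h)) x).symm
    · rw [dif_neg h, dif_neg (mt key.1 h)]

theorem functionalOf_homOfFunctional (φ : N.obj c →ₗ[k] k) (hφ) :
    functionalOf (homOfFunctional (J := J) φ hφ) = φ := by
  ext x
  change dite _ _ _ = _
  rw [dif_pos (by rw [map_zero, zero_add])]
  exact congrArg φ (congrArg (fun v => N.map v x) (hom_ext_exponent (g := 𝟙 c) rfl) |>.trans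
    (by rw [N.map_id]; rfl))

end Functional

/-- Maps into the module are the dual of `N(c)`, and functionals extend along injections of vector
spaces. -/
instance injective_coModule (c : Fin r → ℤ) : Injective (coModule k a ∅ c) where
  factors {X Y} g f _ := by
    change X ⟶ coModule k a ∅ (degreeOf (objOf a c)) at g
    have hinj : Function.Injective (f.app (objOf a c)).hom :=
      (ModuleCat.mono_iff_injective _).1 inferInstance
    obtain ⟨s, hs⟩ := (f.app (objOf a c)).hom.exists_leftInverse_of_injective
      (LinearMap.ker_eq_bot.2 hinj)
    refine ⟨homOfFunctional (c := objOf a c) (functionalOf g ∘ₗ s) (by simp),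
      functionalOf_injective (c := objOf a c) ?_⟩
    ext x
    have h : functionalOf (homOfFunctional (J := ∅) (c := objOf a c) (functionalOf g ∘ₗ s)
        (by simp)) (f.app (objOf a c) x) = functionalOf g (s (f.app (objOf a c) x)) := by
      rw [functionalOf_homOfFunctional]; rfl
    exact h.trans (congrArg (functionalOf g) (LinearMap.congr_fun hs x))

/-! ### Dual Koszul sequences -/

section KoszulSequence

variable (k a)

/-- The degree of the variable `xⱼ`. -/
abbrev genDegree (j : Fin n) : Fin r → ℤ := monomialDegree a (Pi.single j 1)

/-- The inclusion between modules of inverse polynomials. -/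
def coIncl {J J' : Finset (Fin n)} (h : J ⊆ J') (c : Fin r → ℤ) :
    coModule k a J' c ⟶ coModule k a J c where
  app d := ModuleCat.ofHom <| Submodule.inclusion fun _ hf u hu =>
    ⟨(hf u hu).1, fun j hj => (hf u hu).2 j (h hj)⟩

/-- Contraction of inverse polynomials with the variable `xⱼ`. -/
def coShift (J : Finset (Fin n)) (c : Fin r → ℤ) (j : Fin n) :
    coModule k a J c ⟶ coModule k a J (c - genDegree a j) where
  app d := ModuleCat.ofHom <|
    (LinearMap.funLeft k k fun u : Fin n → ℕ => u + Pi.single j 1).restrict fun g hg u hu => by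
      obtain ⟨h₁, h₂⟩ := hg _ hu
      refine ⟨?_, fun i hi => (add_eq_zero.1 (h₂ i hi)).1⟩
      rw [← h₁, map_add]
      abel
  naturality d d' f := by
    ext x
    refine Subtype.ext (funext fun u => ?_)
    change x.1 (u + Pi.single j 1 + exponent f) = x.1 (u + exponent f + Pi.single j 1)
    rw [add_right_comm]

variable {k a}

theorem coShift_app_apply {J : Finset (Fin n)} {c : Fin r → ℤ} {j : Fin n} {d : ActCat a}
    (x : (coModule k a J c).obj d) (u : Fin n → ℕ) :
    ((coShift k a J c j).app d x).1 u = x.1 (u + Pi.single j 1) := rfl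

theorem exists_add_single {u : Fin n → ℕ} {j : Fin n} (h : u j ≠ 0) :
    ∃ v : Fin n → ℕ, u = v + Pi.single j 1 :=
  ⟨u - Pi.single j 1, (tsub_add_cancel_of_le (by
    intro i
    rcases eq_or_ne i j with rfl | hi
    · rw [Pi.single_eq_same]
      exact Nat.one_le_iff_ne_zero.2 h
    · simp [hi])).symm⟩

theorem coShift_app_surjective {J : Finset (Fin n)} {j : Fin n} (hj : j ∉ J) (c : Fin r → ℤ)
    (d : ActCat a) : Function.Surjective ((coShift k a J c j).app d) := by
  intro y
  -- The preimage is `y` times `xⱼ`, extended by zero; as `j ∉ J`, its support still avoids the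
  -- variables in `J`.
  refine ⟨⟨fun u => if u j = 0 then 0 else y.1 (u - Pi.single j 1), fun u hu => ?_⟩, ?_⟩
  · dsimp only at hu
    split_ifs at hu with h
    · exact absurd rfl hu
    · obtain ⟨v, rfl⟩ := exists_add_single h
      rw [add_tsub_cancel_right] at hu
      obtain ⟨h₁, h₂⟩ := y.2 v hu
      refine ⟨by rw [map_add, add_right_comm, h₁, sub_add_cancel], fun i hi => ?_⟩
      have : i ≠ j := fun h => hj (h ▸ hi)
      simp [h₂ i hi, this]
  · refine Subtype.ext (funext fun u => ?_)
    change (if (u + Pi.single j 1 : Fin n → ℕ) j = 0 then 0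
      else y.1 (u + Pi.single j 1 - Pi.single j 1)) = y.1 u
    rw [if_neg (by simp), add_tsub_cancel_right]

theorem isKernelOfEpi_coShift {J : Finset (Fin n)} {j : Fin n} (hj : j ∉ J) (c : Fin r → ℤ) :
    IsKernelOfEpi (coIncl k a (Finset.subset_insert j J) c) (coShift k a J c j) where
  mono := by
    have (d : ActCat a) : Mono ((coIncl k a (Finset.subset_insert j J) c).app d) :=
      (ModuleCat.mono_iff_injective _).2 fun y z hyz => Subtype.ext (congrArg (fun t => t.1) hyz)
    exact NatTrans.mono_of_mono_app _
  epi := by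
    have (d : ActCat a) : Epi ((coShift k a J c j).app d) :=
      (ModuleCat.epi_iff_surjective _).2 (coShift_app_surjective hj c d)
    exact NatTrans.epi_of_epi_app _
  comp_eq_zero := by
    ext d x
    refine Subtype.ext (funext fun u => ?_)
    change x.1 (u + Pi.single j 1) = 0
    by_contra h
    simpa using (x.2 _ h).2 j (Finset.mem_insert_self j J)
  exists_lift {X} h hh := by
    have hmem (d : ActCat a) (x : X.obj d) :
        (h.app d x).1 ∈ coComponent k a (insert j J) c (degreeOf d) := by
      intro u hu
      obtain ⟨h₁, h₂⟩ := (h.app d x).2 u hu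
      refine ⟨h₁, Finset.forall_mem_insert _ _ _ |>.2 ⟨?_, h₂⟩⟩
      by_contra hne
      obtain ⟨v, rfl⟩ := exists_add_single hne
      refine hu ?_
      rw [← coShift_app_apply (h.app d x), ← ConcreteCategory.comp_apply, ← NatTrans.comp_app, hh]
      rfl
    refine ⟨{ app d := ModuleCat.ofHom
                (((coComponent k a J c (degreeOf d)).subtype ∘ₗ (h.app d).hom).codRestrict _
                  (hmem d))
              naturality d d' f := ?_ }, rfl⟩
    ext x
    have hx := congrArg Subtype.val (NatTrans.naturality_apply h f x)
    exact Subtype.ext hx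

theorem subsetDegree_insert {I : Finset (Fin n)} {j : Fin n} (hj : j ∉ I) :
    subsetDegree a (insert j I) = genDegree a j + subsetDegree a I := by
  rw [subsetDegree, Finset.sum_insert hj, subsetDegree]
  congr 1
  simp [genDegree, monomialDegree, Pi.single_apply]

theorem HomAcyclic.coModule_union {M : ActCat a ⥤ ModuleCat.{w} k} {P : ProjectiveResolution M}
    {T J : Finset (Fin n)} (hTJ : Disjoint T J) (c : Fin r → ℤ)
    (h : ∀ I ⊆ J, HomAcyclic P (coModule k a T (c - subsetDegree a I))) :
    HomAcyclic P (coModule k a (T ∪ J) c) := by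
  induction J using Finset.induction_on generalizing c with
  | empty => simpa [subsetDegree] using h ∅ (Finset.Subset.refl _)
  | insert j J hj ih =>
    rw [Finset.disjoint_insert_right] at hTJ
    rw [Finset.union_insert]
    -- The middle term accounts for the subsets `I` without `j`, the shifted quotient for the
    -- subsets `insert j I`.
    refine HomAcyclic.of_isKernelOfEpi (isKernelOfEpi_coShift (by simp [hTJ.1, hj]) c)
      (ih hTJ.2 c fun I hI => h I (hI.trans (Finset.subset_insert j J)))
      (ih hTJ.2 _ fun I hI => ?_)
    have := h (insert j I) (Finset.insert_subset_insert j hI)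
    rwa [subsetDegree_insert fun h => hj (hI h), ← sub_sub] at this

theorem HomAcyclic.coModule_of_subsingleton {M : ActCat a ⥤ ModuleCat.{w} k}
    (P : ProjectiveResolution M) (c : Fin r → ℤ) (h : Subsingleton (M.obj (objOf a c))) :
    HomAcyclic P (coModule k a ∅ c) :=
  HomAcyclic.of_injective P fun m => functionalOf_injective (c := objOf a c) <|
    LinearMap.ext fun x => by rw [Subsingleton.elim x 0, map_zero, map_zero]

variable (a) in
/-- Multiplication by the variable `xⱼ`. -/
def varHom (c : Fin r → ℤ) (j : Fin n) : objOf a (c - genDegree a j) ⟶ objOf a c :=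
  homOf (Pi.single j 1) (add_sub_cancel (genDegree a j) c)

theorem functionalOf_comp_coShift {N : ActCat a ⥤ ModuleCat.{w} k} {J : Finset (Fin n)}
    {c : Fin r → ℤ} {j : Fin n} (f : N ⟶ coModule k a J (degreeOf (objOf a c))) :
    functionalOf (c := objOf a (c - genDegree a j)) (f ≫ coShift k a J c j) =
      functionalOf f ∘ₗ (N.map (varHom a c j)).hom := by
  ext x
  refine Eq.trans ?_ (functionalOf_map_apply f (varHom a c j) x).symm
  change (f.app _ x).1 (0 + Pi.single j 1) = _
  rw [zero_add]
  rfl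

/-- On maps from `M`, contraction is the dual of multiplication by `xⱼ`: surjectivity of the latter
kills Ext⁰, its inverse kills Ext¹. -/
theorem HomAcyclic.coModule_of_bijective {M : ActCat a ⥤ ModuleCat.{w} k}
    (P : ProjectiveResolution M) (c : Fin r → ℤ) (j : Fin n)
    (h : Function.Bijective (M.map (varHom a c j)).hom) :
    HomAcyclic P (coModule k a {j} c) := by
  have hk := isKernelOfEpi_coShift (k := k) (a := a) (Finset.notMem_empty j) c
  refine HomAcyclic.of_isKernelOfEpi_of_injective P hk (fun m => ?_) fun m => ?_
  · refine functionalOf_injective (c := objOf a c) (LinearMap.ext fun x => ?_)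
    obtain ⟨y, rfl⟩ := h.2 x
    refine (functionalOf_map_apply (c := objOf a c) m (varHom a c j) y).trans ?_
    by_contra hne
    have h₀ : (Pi.single j 1 : Fin n → ℕ) j = 0 :=
      ((m.app _ y).2 _ hne).2 j (Finset.mem_insert_self j ∅)
    simp at h₀
  · let e := LinearEquiv.ofBijective _ h
    refine ⟨homOfFunctional (c := objOf a c)
      (functionalOf (c := objOf a (c - genDegree a j)) m ∘ₗ e.symm.toLinearMap) (by simp), ?_⟩
    refine functionalOf_injective (c := objOf a (c - genDegree a j)) ?_
    refine (functionalOf_comp_coShift _).trans ?_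
    rw [functionalOf_homOfFunctional]
    ext x
    exact congrArg (functionalOf (c := objOf a (c - genDegree a j)) m) (e.symm_apply_apply x)

end KoszulSequence

/-- The target is one-dimensional and concentrated at `c`, as only the exponent `0` is allowed. -/
theorem epi_of_ne_zero_coModule_univ {c : ActCat a} {N : ActCat a ⥤ ModuleCat.{w} k}
    (g : N ⟶ coModule k a Finset.univ (degreeOf c)) (hg : g ≠ 0) : Epi g := by
  have hφ : functionalOf g ≠ 0 := fun h => hg (functionalOf_injective h)
  obtain ⟨x, hx⟩ := DFunLike.ne_iff.1 hφ
  have hsupp {d : ActCat a} (y : (coModule k a Finset.univ (degreeOf c)).obj d) (u : Fin n → ℕ)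
      (hu : y.1 u ≠ 0) : u = 0 := funext fun j => (y.2 u hu).2 j (Finset.mem_univ j)
  have (d : ActCat a) : Epi (g.app d) := by
    refine (ModuleCat.epi_iff_surjective _).2 fun y => ?_
    by_cases hy : y.1 0 = 0
    · refine ⟨0, ?_⟩
      rw [map_zero]
      refine Subtype.ext (funext fun u => ?_)
      by_contra hu
      have hu' : y.1 u ≠ 0 := fun h => hu h.symm
      exact hu' (by rw [hsupp y u hu', hy])
    · have hdc : d = c := by
        have h := (y.2 0 hy).1
        rw [map_zero, zero_add] at h
        rw [← ActionCategory.back_coe d, ← ActionCategory.back_coe c]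
        exact congrArg (fun z : Degrees a => (z : ActCat a)) h
      subst hdc
      refine ⟨(y.1 0 / functionalOf g x) • x, ?_⟩
      rw [map_smul]
      refine Subtype.ext (funext fun u => ?_)
      by_cases hu : u = 0
      · subst hu
        exact div_mul_cancel₀ _ hx
      · exact (not_not.1 (mt (hsupp _ u) hu)).trans (not_not.1 (mt (hsupp _ u) hu)).symm
  exact NatTrans.epi_of_epi_app _

/-- A functional on `Spl` pulls back to one killing the radical, hence all multiples of variables;
it is thus a map to the simple module at `c`. -/
theorem subsingleton_spl {M : ActCat a ⥤ ModuleCat.{w} k} {P : ProjectiveResolution M}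
    (hP : IsMinimalResolution P) {c : ActCat a}
    (hac : HomAcyclic P (coModule k a Finset.univ (degreeOf c))) (m : ℕ) :
    Subsingleton (Spl (P.complex.X m) c) := by
  refine subsingleton_of_forall_eq 0 fun x => ?_
  rw [← Module.forall_dual_apply_eq_zero_iff k]
  intro φ
  obtain ⟨x, rfl⟩ := Submodule.mkQ_surjective _ x
  have hφ (b : ActCat a) (v : b ⟶ c) (x : (P.complex.X m).obj b)
      (hv : ∃ j ∈ Finset.univ, exponent v j ≠ 0) :
      (φ ∘ₗ (rad (P.complex.X m) c).mkQ) ((P.complex.X m).map v x) = 0 := by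
    have hni : ¬ IsIso v := by
      intro
      obtain ⟨j, -, hj⟩ := hv
      exact hj (congrFun (exponent_eq_zero_of_isIso v) j)
    have hmem : (P.complex.X m).map v x ∈ rad (P.complex.X m) c :=
      Submodule.mem_iSup_of_mem b <| Submodule.mem_iSup_of_mem v <|
        Submodule.mem_iSup_of_mem hni ⟨x, rfl⟩
    exact (congrArg φ ((Submodule.Quotient.mk_eq_zero _).2 hmem)).trans (map_zero φ)
  have h := hP.hom_eq_zero epi_of_ne_zero_coModule_univ hac m (homOfFunctional _ hφ)
  have h' := functionalOf_homOfFunctional _ hφ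
  rw [h] at h'
  exact (LinearMap.congr_fun h' x).symm

end Cofree

/-! ### Toric rings and upper bounds -/

section Toric

universe w

variable {k : Type w} [Field k] {r n : ℕ} {a : Fin n → Fin r → ℕ}

theorem exists_eq_single {c : Fin r → ℤ} {x : ToricRing k a} (hx : x ∈ toricComponent k a c)
    (hx₀ : x ≠ 0) : ∃ (q : semigroup a) (s : k), (q : Fin r → ℤ) = c ∧ s ≠ 0 ∧
      x = AddMonoidAlgebra.single q s := by
  have hne : x.coeff ≠ 0 := fun h => hx₀ (AddMonoidAlgebra.ext h)
  obtain ⟨q, hq⟩ := Finsupp.support_nonempty_iff.2 hne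
  refine ⟨q, x.coeff q, hx q hq, Finsupp.mem_support_iff.1 hq,
    AddMonoidAlgebra.ext (Finsupp.ext fun m => ?_)⟩
  rw [AddMonoidAlgebra.coeff_single]
  by_cases hm : q = m
  · rw [← hm, Finsupp.single_eq_same]
  · rw [Finsupp.single_eq_of_ne' hm]
    by_contra hmx
    exact hm (Subtype.ext ((hx q hq).trans (hx m (Finsupp.mem_support_iff.2 hmx)).symm))

theorem subsingleton_toricComponent {c : Fin r → ℤ} (hc : c ∉ semigroup a) :
    Subsingleton (toricComponent k a c) := by
  refine subsingleton_of_forall_eq 0 fun x => Subtype.ext ?_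
  by_contra hx
  obtain ⟨q, -, rfl, -⟩ := exists_eq_single x.2 hx
  exact hc q.2

/-- Each component is zero or spanned by one monomial, and monomials go to monomials. -/
theorem toricMul_bijective {u : Fin n → ℕ} {c d : Fin r → ℤ} (h : monomialDegree a u + c = d)
    (hcd : d ∈ semigroup a → c ∈ semigroup a) : Function.Bijective (toricMul k a u h) := by
  constructor
  · rw [← LinearMap.ker_eq_bot, LinearMap.ker_eq_bot']
    intro x hx
    by_contra hx₀
    obtain ⟨q, s, -, hs, hxs⟩ := exists_eq_single x.2 fun h => hx₀ (Subtype.ext h)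
    have hx' : toricMonomial k a u * x.1 = 0 := congrArg Subtype.val hx
    rw [hxs, toricMonomial, AddMonoidAlgebra.single_mul_single, one_mul,
      AddMonoidAlgebra.single_eq_zero] at hx'
    exact hs hx'
  · intro y
    by_cases hy : y.1 = 0
    · exact ⟨0, by rw [map_zero]; exact Subtype.ext hy.symm⟩
    · obtain ⟨q, s, hq, -, hys⟩ := exists_eq_single y.2 hy
      have hc : c ∈ semigroup a := hcd (hq ▸ q.2)
      refine ⟨⟨AddMonoidAlgebra.single ⟨c, hc⟩ s,
        AddMonoidAlgebra.single_mem_gradeBy (semigroup a).subtype ⟨c, hc⟩ s⟩, Subtype.ext ?_⟩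
      change toricMonomial k a u * AddMonoidAlgebra.single ⟨c, hc⟩ s = y.1
      rw [hys, toricMonomial, AddMonoidAlgebra.single_mul_single, one_mul]
      congr 1
      exact Subtype.ext (h.trans hq.symm)

theorem subsetDegree_mem (I : Finset (Fin n)) : subsetDegree a I ∈ semigroup a := by
  refine AddSubmonoid.sum_mem _ fun i _ => ⟨Pi.single i 1, ?_⟩
  simp [monomialDegree, Pi.single_apply]

theorem leq_subsetDegree_iff {I : Finset (Fin n)} {c : Fin r → ℤ} :
    LEQ a (subsetDegree a I) c ↔ c - subsetDegree a I ∈ semigroup a := by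
  constructor
  · rintro ⟨q, hq, rfl⟩
    rwa [add_sub_cancel_left]
  · exact fun h => ⟨_, h, add_sub_cancel _ _⟩

theorem subsetDegree_mono {I F : Finset (Fin n)} (h : I ⊆ F) :
    LEQ a (subsetDegree a I) (subsetDegree a F) := by
  refine ⟨subsetDegree a (F \ I), subsetDegree_mem _, ?_⟩
  rw [add_comm]
  exact Finset.sum_sdiff h

theorem exists_subset_facet {I : Finset (Fin n)} {c : Fin r → ℤ} (hI : I ∈ degreeComplex a c) :
    ∃ F ∈ facets a c, I ⊆ F := by
  obtain ⟨F, hIF, hF⟩ := (Set.toFinite (degreeComplex a c)).exists_le_maximal hI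
  exact ⟨F, hF, hIF⟩

theorem LEQ.trans {b c d : Fin r → ℤ} (hbc : LEQ a b c) (hcd : LEQ a c d) : LEQ a b d := by
  obtain ⟨q, hq, rfl⟩ := hbc
  obtain ⟨q', hq', rfl⟩ := hcd
  exact ⟨q + q', add_mem hq hq', (add_assoc _ _ _).symm⟩

theorem not_bettiObjects_of_homAcyclic {M : ActCat a ⥤ ModuleCat.{w} k} {c : ActCat a}
    (h : ∀ P : ProjectiveResolution M,
      HomAcyclic P (coModule k a Finset.univ (degreeOf c))) : ¬ bettiObjects M c := by
  rintro ⟨P, hP, m, hm⟩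
  have := subsingleton_spl hP (h P) m
  exact not_subsingleton _ this

theorem degreeOf_mem_semigroup {c : ActCat a} (hc : bettiObjects (toricModule k a) c) :
    degreeOf c ∈ semigroup a := by
  by_contra hcQ
  refine not_bettiObjects_of_homAcyclic (fun P => ?_) hc
  rw [← Finset.empty_union Finset.univ]
  refine HomAcyclic.coModule_union (Finset.disjoint_empty_left _) _ fun I _ =>
    HomAcyclic.coModule_of_subsingleton P _ (subsingleton_toricComponent fun h => hcQ ?_)
  change degreeOf c - subsetDegree a I ∈ semigroup a at h
  rw [← sub_add_cancel (degreeOf c) (subsetDegree a I)]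
  exact add_mem h (subsetDegree_mem I)

theorem isMinimalUpperBound_of_bettiObjects {c : ActCat a}
    (hc : bettiObjects (toricModule k a) c) :
    IsMinimalUpperBound a (subsetDegree a '' facets a (degreeOf c)) (degreeOf c) := by
  refine ⟨degreeOf_mem_semigroup hc, ?_, fun b _ hbF hbc => ?_⟩
  · rintro _ ⟨F, hF, rfl⟩
    exact hF.prop
  · by_contra hne
    obtain ⟨_, ⟨u, rfl⟩, hu⟩ := hbc
    have hu₀ : u ≠ 0 := by
      rintro rfl
      exact hne (by rw [← hu, map_zero, add_zero])
    obtain ⟨j, hj⟩ := Function.ne_iff.1 hu₀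
    -- Now `c = b + A(v) + aⱼ`, so `b ≤ c - aⱼ`.
    obtain ⟨v, rfl⟩ := exists_add_single hj
    refine not_bettiObjects_of_homAcyclic (fun P => ?_) hc
    rw [← Finset.insert_erase (Finset.mem_univ j), Finset.insert_eq]
    refine HomAcyclic.coModule_union
      (Finset.disjoint_singleton_left.2 (Finset.notMem_erase j _)) _ fun I _ =>
        HomAcyclic.coModule_of_bijective P _ j (toricMul_bijective (exponent_spec _) fun h => ?_)
    change degreeOf c - subsetDegree a I ∈ semigroup a at h
    change degreeOf c - subsetDegree a I - genDegree a j ∈ semigroup a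
    -- The face `I` lies in a facet `F`, so `deg I ≤ deg F ≤ b`; adding `A(v)` gives the claim.
    obtain ⟨F, hF, hIF⟩ := exists_subset_facet (leq_subsetDegree_iff.2 h)
    have hIb := leq_subsetDegree_iff.1 ((subsetDegree_mono hIF).trans (hbF _ ⟨F, hF, rfl⟩))
    have hv : monomialDegree a v ∈ semigroup a := ⟨v, rfl⟩
    convert add_mem hIb hv using 1
    rw [← hu, map_add]
    abel

end Toric

end

end ToricBetti

theorem mainTheorem7 {k : Type*} [Field k] {r n : ℕ} (a : Fin n → Fin r → ℕ)
    (ha : ToricBetti.IsMinimalGenerators a) :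
    (∃ J : ToricBetti.BettiCategory (ToricBetti.toricModule k a) ⥤ ToricBetti.LubCategory a,
      J.Full ∧ J.Faithful ∧
        J ⋙ (ToricBetti.lubObjects a).ι =
          (ToricBetti.bettiObjects (ToricBetti.toricModule k a)).ι) ∧
    ∀ c : ToricBetti.ActCat a, ToricBetti.bettiObjects (ToricBetti.toricModule k a) c →
      ToricBetti.IsMinimalUpperBound a
        (ToricBetti.subsetDegree a '' ToricBetti.facets a (ToricBetti.degreeOf c))
        (ToricBetti.degreeOf c) := by
  have h (c : ToricBetti.ActCat a)
      (hc : ToricBetti.bettiObjects (ToricBetti.toricModule k a) c) :=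
    ToricBetti.isMinimalUpperBound_of_bettiObjects hc
  have hle : ToricBetti.bettiObjects (ToricBetti.toricModule k a) ≤ ToricBetti.lubObjects a :=
    fun c hc => ⟨(h c hc).1, _, h c hc⟩
  exact ⟨⟨ObjectProperty.ιOfLE hle, inferInstance, inferInstance, rfl⟩, h⟩
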